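/- Let $R>0$ and $\kappa\ge 1$ be fixed. For $\tau>0$ let $\mathrm{SP}_\tau(z)=\frac1\tau\log(1+e^{\tau z})$, and for $d,m\in\mathbb N$, $m\ge1$, and $B>0$ let $$\mathcal F^m_{\mathrm{SP}_\tau}(B)=\Big\{\phi(x)=c+\tfrac1m\sum_{k=1}^m a_k\,\mathrm{SP}_\tau(\omega_k\cdot x+b_k)\ \Big|\ |c|\le 2B,\ |a_k|\le 16B,\ |\omega_k|_1=1,\ |b_k|\le 1\Big\}$$ be the set of two-layer SoftPlus networks on $\mathbb R^d$ of width $m$ with bounded parameters. Let $\Omega\subset[-R,R]^d$, let $\rho$ be a Borel probability measure on $\mathbb{R}^d$ concentrated on $\Omega$, and let $y$ be a ($\rho$-a.e.) measurable function with $|y|\le Y$ on $\Omega$, where $Y>0$. Define, with $|\nabla\phi|$ the Euclidean norm of the gradient, $$L^{TV}(\phi)=\mathbb E_{x\sim\rho}\big[\phi(x)^2-2\phi(x)y(x)+|\nabla\phi(x)|\big],\qquad L^{Tik}(\phi)=\mathbb E_{x\sim\rho}\big[\phi(x)^2-2\phi(x)y(x)+|\nabla\phi(x)|^2\big],$$ and,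 for points $x_1,\dots,x_N$, let $L_N^{TV}(\phi)$ and $L_N^{Tik}(\phi)$ be the averages over $x_1,\dots,x_N$ of the same integrands. Then there are constants $Z_1=Z_1(B,d,Y)$, $Z_2=Z_2(B,d)$, $Z_3=Z_3(B,d)$, $M_1=M_1(B,Y)$, $M_2=M_2(B,Y)$, depending only on the quantities shown (and on the fixed $R$, $\kappa$), such that for all $\Omega,\rho,y$ as above, all $m,N\ge1$, all $\tau$ with $\frac1\kappa\le\tau\le\kappa\sqrt m$ (in particular $\tau=\sqrt m$), and every $\epsilon\in(0,1)$, if $x_1,\dots,x_N$ are i.i.d. with law $\rho$, then with probability at least $1-\epsilon$ $$\sup_{\phi\in\mathcal F^m_{\mathrm{SP}_\tau}(B)}\big|L^{TV}_N(\phi)-L^{TV}(\phi)\big|\le 2\frac{\sqrt m}{\sqrt N}\big(Z_1+Z_2\sqrt{\log m}\big)+M_1\frac{\sqrt{-2\log\epsilon}}{\sqrt N},$$ and likewise with probability at least $1-\epsilon$ $$\sup_{\phi\in\mathcal F^m_{\mathrm{SP}_\tau}(B)}\big|L^{Tik}_N(\phi)-L^{Tik}(\phi)\big|\le 2\frac{\sqrt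 m}{\sqrt N}\big(Z_1+Z_3\sqrt{\log m}\big)+M_2\frac{\sqrt{-2\log\epsilon}}{\sqrt N}.$$ -/

import Mathlib

open MeasureTheory

noncomputable section

/-- The SoftPlus activation `SP_τ(z) = (1/τ) log (1 + exp (τ z))`. -/
def softplus (τ z : ℝ) : ℝ := 1 / τ * Real.log (1 + Real.exp (τ * z))

/-- The set `F^m_σ(B)` of two-layer networks of width `m` on `ℝ^d` with activation `σ`
and bounded parameters. -/
def networkClass (σ : ℝ → ℝ) (d m : ℕ) (B : ℝ) : Set (EuclideanSpace ℝ (Fin d) → ℝ) :=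
  {φ | ∃ (c : ℝ) (a b : Fin m → ℝ) (w : Fin m → EuclideanSpace ℝ (Fin d)),
      |c| ≤ 2 * B ∧
      (∀ k, |a k| ≤ 16 * B) ∧ (∀ k, ∑ i, |w k i| = 1) ∧ (∀ k, |b k| ≤ 1) ∧
      φ = fun x => c + 1 / (m : ℝ) * ∑ k, a k * σ (inner ℝ (w k) x + b k)}

/-- The integrand `φ² - 2 φ y + |∇φ|` of the TV regularized loss. -/
def tvIntegrand {d : ℕ} (y φ : EuclideanSpace ℝ (Fin d) → ℝ) (x : EuclideanSpace ℝ (Fin d)) : ℝ :=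
  φ x ^ 2 - 2 * φ x * y x + ‖gradient φ x‖

/-- The integrand `φ² - 2 φ y + |∇φ|²` of the Tikhonov regularized loss. -/
def tikIntegrand {d : ℕ} (y φ : EuclideanSpace ℝ (Fin d) → ℝ) (x : EuclideanSpace ℝ (Fin d)) : ℝ :=
  φ x ^ 2 - 2 * φ x * y x + ‖gradient φ x‖ ^ 2

/-- The expected TV loss. -/
def lossTV {d : ℕ} (ρ : Measure (EuclideanSpace ℝ (Fin d))) (y φ : EuclideanSpace ℝ (Fin d) → ℝ) :
    ℝ :=
  ∫ x, tvIntegrand y φ x ∂ρ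

/-- The expected Tikhonov loss. -/
def lossTik {d : ℕ} (ρ : Measure (EuclideanSpace ℝ (Fin d))) (y φ : EuclideanSpace ℝ (Fin d) → ℝ) :
    ℝ :=
  ∫ x, tikIntegrand y φ x ∂ρ

/-- The empirical TV loss of the sample `x_1, …, x_N`. -/
def empiricalLossTV {d N : ℕ} (x : Fin N → EuclideanSpace ℝ (Fin d))
    (y φ : EuclideanSpace ℝ (Fin d) → ℝ) : ℝ :=
  1 / (N : ℝ) * ∑ i, tvIntegrand y φ (x i)

/-- The empirical Tikhonov loss of the sample `x_1, …, x_N`. -/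
def empiricalLossTik {d N : ℕ} (x : Fin N → EuclideanSpace ℝ (Fin d))
    (y φ : EuclideanSpace ℝ (Fin d) → ℝ) : ℝ :=
  1 / (N : ℝ) * ∑ i, tikIntegrand y φ (x i)

end

open ProbabilityTheory Filter Topology

/-! The loss deviation is controlled by chaining in parameter space. A network has `m * (d + 2) + 1`
real parameters in a cube, so at scale `D / 2 ^ j` a family bounded by `D` and `L`-Lipschitz in the
parameters has a net whose log-cardinality is at most of order `m * (d + 3) * (log H + j)`, with `H`
of order `1 + L / D`. Hoeffding's inequality and a union bound over the links between successive
nets control all telescoping increments at once. Summing them gives a deviation of order `D * √(m *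
(d + 3) * log H / N)`, plus a confidence term free of `m` and `d`
(`measure_not_forall_abs_empiricalDeviation_le_of_lipschitz`).

The integrand is split into the fit `φ ^ 2 - 2 * φ * y` and the regularizer, each treated with
failure probability `ε / 2`. SoftPlus is 1-Lipschitz for every `τ`, so the fit has a Lipschitz
constant free of `m` and gives no `log m`. The gradient involves `sigmoid (τ * z)`, whose slope
grows with `τ ≤ κ * √m`; its Lipschitz constant is of order `√m`, which enters only through `log H`
and yields `√(log m)`. The split also keeps `Y` out of the coefficient of `√(log m)`, since that
coefficient sees only the bound on the regularizer, `16 * B` or `(16 * B) ^ 2`. The pairing of `|ω|₁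
= 1` with the sup norm of `x` makes all sup bounds, hence `M₁` and `M₂`, independent of `d`. -/

/-- The difference between the average of `g` over the sample `x` and its expectation. -/
noncomputable def empiricalDeviation {X : Type*} [MeasurableSpace X] (ρ : Measure X) {N : ℕ}
    (x : Fin N → X) (g : X → ℝ) : ℝ :=
  1 / (N : ℝ) * ∑ i, g (x i) - ∫ z, g z ∂ρ

/-! ### Hoeffding's inequality and chaining for empirical means -/

section Deviation

variable {X : Type*} [MeasurableSpace X] {ρ : Measure X}

theorem integrable_of_ae_abs_le [IsFiniteMeasure ρ] {g : X → ℝ} {a : ℝ}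
    (hg : AEMeasurable g ρ) (hb : ∀ᵐ x ∂ρ, |g x| ≤ a) : Integrable g ρ :=
  Integrable.of_bound hg.aestronglyMeasurable a (by simpa using hb)

theorem empiricalDeviation_sub {N : ℕ} (x : Fin N → X) {g h : X → ℝ}
    (hg : Integrable g ρ) (hh : Integrable h ρ) :
    empiricalDeviation ρ x (fun z => g z - h z) =
      empiricalDeviation ρ x g - empiricalDeviation ρ x h := by
  simp only [empiricalDeviation, integral_sub hg hh, Finset.sum_sub_distrib]
  ring

theorem empiricalDeviation_add {N : ℕ} (x : Fin N → X) {g h : X → ℝ}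
    (hg : Integrable g ρ) (hh : Integrable h ρ) :
    empiricalDeviation ρ x (fun z => g z + h z) =
      empiricalDeviation ρ x g + empiricalDeviation ρ x h := by
  simp only [empiricalDeviation, integral_add hg hh, Finset.sum_add_distrib]
  ring

theorem abs_empiricalDeviation_le [IsProbabilityMeasure ρ] {N : ℕ} (hN : 0 < N) (x : Fin N → X)
    {g : X → ℝ} {δ : ℝ} (hb : ∀ᵐ z ∂ρ, |g z| ≤ δ) (hx : ∀ i, |g (x i)| ≤ δ) :
    |empiricalDeviation ρ x g| ≤ 2 * δ := by
  have hN' : (0 : ℝ) < N := by exact_mod_cast hN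
  have h1 : |∫ z, g z ∂ρ| ≤ δ := by
    simpa using norm_integral_le_of_norm_le_const (μ := ρ) (f := g) (C := δ) (by simpa using hb)
  have h2 : |1 / (N : ℝ) * ∑ i, g (x i)| ≤ δ := by
    rw [abs_mul, abs_of_pos (by positivity), one_div, inv_mul_le_iff₀ hN']
    calc |∑ i, g (x i)| ≤ ∑ i, |g (x i)| := Finset.abs_sum_le_sum_abs _ _
      _ ≤ ∑ _i : Fin N, δ := Finset.sum_le_sum fun i _ => hx i
      _ = N * δ := by simp
  calc |empiricalDeviation ρ x g| ≤ |1 / (N : ℝ) * ∑ i, g (x i)| + |∫ z, g z ∂ρ| := abs_sub _ _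
    _ ≤ 2 * δ := by linarith

/-- One-sided Hoeffding inequality for the empirical mean of a bounded function. -/
theorem measure_lt_empiricalDeviation_le [IsProbabilityMeasure ρ] {N : ℕ} (hN : 0 < N)
    {g : X → ℝ} {a w : ℝ} (ha : 0 < a) (hw : 0 ≤ w) (hg : AEMeasurable g ρ)
    (hb : ∀ᵐ x ∂ρ, |g x| ≤ a) :
    Measure.pi (fun _ : Fin N => ρ) {x | a * w / √(N : ℝ) < empiricalDeviation ρ x g} ≤
      ENNReal.ofReal (Real.exp (-w ^ 2 / 2)) := by
  have hN' : (0 : ℝ) < N := by exact_mod_cast hN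
  set P := Measure.pi (fun _ : Fin N => ρ)
  have hind : iIndepFun (fun (i : Fin N) (x : Fin N → X) => g (x i) - ∫ z, g z ∂ρ) P :=
    iIndepFun_pi (X := fun _ z => g z - ∫ z, g z ∂ρ) fun _ => hg.sub_const _
  have hsub : ∀ i : Fin N, HasSubgaussianMGF (fun x : Fin N → X => g (x i) - ∫ z, g z ∂ρ)
      ((‖a - (-a)‖₊ / 2) ^ 2) P := by
    intro i
    have hq : Measure.QuasiMeasurePreserving (Function.eval i) P ρ :=
      Measure.quasiMeasurePreserving_eval (fun _ : Fin N => ρ) i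
    have h := hasSubgaussianMGF_of_mem_Icc (μ := P) (X := fun x : Fin N → X => g (x i))
      (a := -a) (b := a) (hg.comp_quasiMeasurePreserving hq)
      (by filter_upwards [hq.ae hb] with x hx using abs_le.mp hx)
    have e : ∫ x : Fin N → X, g (x i) ∂P = ∫ z, g z ∂ρ :=
      integral_comp_eval (μ := fun _ : Fin N => ρ) (i := i) hg.aestronglyMeasurable
    rwa [e] at h
  -- Each summand has variance proxy `a ^ 2`, so the sum exceeds `a * w * √N` with probability at
  -- most `exp (-(a * w * √N) ^ 2 / (2 * N * a ^ 2)) = exp (-w ^ 2 / 2)`.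
  have hH := HasSubgaussianMGF.measure_sum_ge_le_of_iIndepFun hind (s := Finset.univ)
    (fun i _ => hsub i) (ε := a * w * √(N : ℝ)) (by positivity)
  have hs : (0 : ℝ) < √(N : ℝ) := Real.sqrt_pos.mpr hN'
  have hsq : √(N : ℝ) * √(N : ℝ) = N := Real.mul_self_sqrt hN'.le
  have hexp : -(a * w * √(N : ℝ)) ^ 2 /
      (2 * ((∑ _i : Fin N, (‖a - (-a)‖₊ / 2) ^ 2 : NNReal) : ℝ)) = -w ^ 2 / 2 := by
    have h1 : ‖a - (-a)‖ = 2 * a := by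
      rw [Real.norm_eq_abs, abs_of_pos (by linarith)]; ring
    push_cast
    rw [h1, Finset.sum_const, Finset.card_univ, Fintype.card_fin, nsmul_eq_mul,
      mul_pow, mul_pow, Real.sq_sqrt hN'.le]
    field_simp
  rw [hexp] at hH
  refine le_trans (measure_mono ?_) (ENNReal.le_ofReal_iff_toReal_le
    (measure_ne_top _ _) (Real.exp_nonneg _) |>.mpr hH)
  intro x hx
  simp only [Set.mem_ofPred_eq, empiricalDeviation] at hx ⊢
  rw [div_lt_iff₀ hs] at hx
  rw [Finset.sum_sub_distrib, Finset.sum_const, Finset.card_univ, Fintype.card_fin, nsmul_eq_mul]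
  have h2 := mul_lt_mul_of_pos_right hx hs
  refine h2.le.trans (le_of_eq ?_)
  rw [mul_assoc, hsq]
  field_simp

/-- Two-sided Hoeffding inequality for the empirical mean of a bounded function. -/
theorem measure_lt_abs_empiricalDeviation_le [IsProbabilityMeasure ρ] {N : ℕ} (hN : 0 < N)
    {g : X → ℝ} {a w : ℝ} (ha : 0 < a) (hw : 0 ≤ w) (hg : AEMeasurable g ρ)
    (hb : ∀ᵐ x ∂ρ, |g x| ≤ a) :
    Measure.pi (fun _ : Fin N => ρ) {x | a * w / √(N : ℝ) < |empiricalDeviation ρ x g|} ≤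
      ENNReal.ofReal (2 * Real.exp (-w ^ 2 / 2)) := by
  have h1 := measure_lt_empiricalDeviation_le hN ha hw hg hb
  have h2 := measure_lt_empiricalDeviation_le hN ha hw hg.neg
    (by simpa using hb : ∀ᵐ x ∂ρ, |(-g) x| ≤ a)
  rw [two_mul, ENNReal.ofReal_add (Real.exp_nonneg _) (Real.exp_nonneg _)]
  refine (measure_mono ?_).trans ((measure_union_le _ _).trans (add_le_add h1 h2))
  intro x hx
  rw [Set.mem_ofPred_eq, lt_abs] at hx
  rcases hx with h | h
  · exact Or.inl h
  · refine Or.inr (h.trans_le (le_of_eq ?_))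
    simp only [empiricalDeviation, Pi.neg_apply, Finset.sum_neg_distrib, integral_neg]
    ring

/-- Hoeffding's inequality and the union bound over a sequence of finite families. -/
theorem measure_not_forall_abs_empiricalDeviation_le [IsProbabilityMeasure ρ] {N : ℕ}
    (hN : 0 < N) {G : ℕ → Finset (X → ℝ)} {a w : ℕ → ℝ} {ε : ℝ} (hε : 0 ≤ ε)
    (ha : ∀ j, 0 < a j) (hw : ∀ j, 0 ≤ w j) (hG : ∀ j, ∀ g ∈ G j, AEMeasurable g ρ)
    (hb : ∀ j, ∀ g ∈ G j, ∀ᵐ x ∂ρ, |g x| ≤ a j)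
    (hcard : ∀ j, ((G j).card : ℝ) * (2 * Real.exp (-w j ^ 2 / 2)) ≤ ε / 2 / 2 ^ j) :
    Measure.pi (fun _ : Fin N => ρ)
      {x | ¬ ∀ j, ∀ g ∈ G j, |empiricalDeviation ρ x g| ≤ a j * w j / √(N : ℝ)} ≤
      ENNReal.ofReal ε := by
  have hsub : {x : Fin N → X |
      ¬ ∀ j, ∀ g ∈ G j, |empiricalDeviation ρ x g| ≤ a j * w j / √(N : ℝ)} ⊆
      ⋃ j, ⋃ g ∈ G j, {x | a j * w j / √(N : ℝ) < |empiricalDeviation ρ x g|} := by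
    intro x hx
    simp only [Set.mem_ofPred_eq, not_forall, not_le] at hx
    obtain ⟨j, g, hg, h⟩ := hx
    simp only [Set.mem_iUnion]
    exact ⟨j, g, hg, h⟩
  refine (measure_mono hsub).trans ((measure_iUnion_le _).trans ?_)
  have hj : ∀ j, Measure.pi (fun _ : Fin N => ρ)
      (⋃ g ∈ G j, {x | a j * w j / √(N : ℝ) < |empiricalDeviation ρ x g|}) ≤
      ENNReal.ofReal (ε / 2 / 2 ^ j) := by
    intro j
    refine (measure_biUnion_finset_le _ _).trans ?_
    refine (Finset.sum_le_sum fun g hg =>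
      measure_lt_abs_empiricalDeviation_le hN (ha j) (hw j) (hG j g hg) (hb j g hg)).trans ?_
    rw [Finset.sum_const, nsmul_eq_mul, ← ENNReal.ofReal_natCast, ← ENNReal.ofReal_mul (by simp)]
    exact ENNReal.ofReal_le_ofReal (hcard j)
  refine (ENNReal.tsum_le_tsum hj).trans ?_
  rw [← ENNReal.ofReal_tsum_of_nonneg (fun j => by positivity) (summable_geometric_two' ε),
    tsum_geometric_two' ε]

theorem ae_pi_forall_mem [SigmaFinite ρ] {Ω : Set X} (hΩ : ρ Ωᶜ = 0) (N : ℕ) :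
    ∀ᵐ x ∂Measure.pi (fun _ : Fin N => ρ), ∀ i, x i ∈ Ω := by
  rw [ae_all_iff]
  intro i
  exact (Measure.quasiMeasurePreserving_eval (fun _ : Fin N => ρ) i).ae (mem_ae_iff.mpr hΩ)

/-- Chaining: a uniform deviation bound for a bounded family of functions admitting finite nets at
the dyadic scales `D / 2 ^ j`. -/
theorem measure_not_forall_abs_empiricalDeviation_le_of_nets [IsProbabilityMeasure ρ] {N : ℕ}
    (hN : 0 < N) {T : Type*} {f : T → X → ℝ} {Ω : Set X} {D V ε : ℝ} {n w : ℕ → ℝ}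
    (hΩ : ρ Ωᶜ = 0) (hε : 0 ≤ ε) (hD : 0 < D) (hw : ∀ j, 0 ≤ w j) (hn : Monotone n)
    (hn1 : ∀ j, 1 ≤ n j)
    (hf : ∀ t, AEMeasurable (f t) ρ) (hb : ∀ t, ∀ x ∈ Ω, |f t x| ≤ D)
    (hnet : ∀ j : ℕ, ∃ S : Finset T, (S.card : ℝ) ≤ n j ∧
      ∀ t, ∃ u ∈ S, ∀ x ∈ Ω, |f t x - f u x| ≤ D / 2 ^ j)
    (hcard : ∀ j, n j ^ 2 * (2 * Real.exp (-w j ^ 2 / 2)) ≤ ε / 2 / 2 ^ j)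
    (hV : ∀ K, ∑ j ∈ Finset.range K, 4 * D / 2 ^ j * w j / √(N : ℝ) ≤ V) :
    Measure.pi (fun _ : Fin N => ρ) {x | ¬ ∀ t, |empiricalDeviation ρ x (f t)| ≤ V} ≤
      ENNReal.ofReal ε := by
  classical
  choose S hScard hSnet using hnet
  have haeΩ : ∀ᵐ x ∂ρ, x ∈ Ω := mem_ae_iff.mpr hΩ
  have hint : ∀ t, Integrable (f t) ρ := fun t =>
    integrable_of_ae_abs_le (hf t) (haeΩ.mono fun x hx => hb t x hx)
  -- Links from level `j` to level `j + 1` along one chain have size at most `D / 2 ^ j + D / 2 ^ (j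
  -- + 1)`, which is below `a (j + 1) = 2 * D / 2 ^ j`.
  let a : ℕ → ℝ := fun j => 4 * D / 2 ^ j
  let links : ℕ → Finset (X → ℝ) := fun j =>
    ((S j ×ˢ S (j + 1)).image fun p => fun z => f p.2 z - f p.1 z)
  -- Level `0` holds the coarsest net itself; later levels keep only the short links. Discarding
  -- long differences gives Hoeffding the small range `a`, and every link of an actual chain
  -- survives the filter.
  let G : ℕ → Finset (X → ℝ) := fun j => Nat.casesOn j ((S 0).image f)
    fun j => (links j).filter fun g => ∀ z ∈ Ω, |g z| ≤ a (j + 1)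
  have hGm : ∀ j, ∀ g ∈ G j, AEMeasurable g ρ := by
    rintro (_ | j) g hg
    · obtain ⟨t, -, rfl⟩ := Finset.mem_image.mp hg
      exact hf t
    · obtain ⟨p, -, rfl⟩ := Finset.mem_image.mp (Finset.mem_filter.mp hg).1
      exact (hf p.2).sub (hf p.1)
  have hGb : ∀ j, ∀ g ∈ G j, ∀ᵐ x ∂ρ, |g x| ≤ a j := by
    rintro (_ | j) g hg
    · obtain ⟨t, -, rfl⟩ := Finset.mem_image.mp hg
      refine haeΩ.mono fun x hx => (hb t x hx).trans ?_
      simp only [a]; norm_num; linarith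
    · exact haeΩ.mono fun x hx => (Finset.mem_filter.mp hg).2 x hx
  have hGc : ∀ j, ((G j).card : ℝ) ≤ n j ^ 2 := by
    rintro (_ | j)
    · have h : ((G 0).card : ℝ) ≤ (S 0).card := by exact_mod_cast Finset.card_image_le
      nlinarith [hScard 0, hn1 0]
    · have h : ((G (j + 1)).card : ℝ) ≤ (S j).card * (S (j + 1)).card := by
        have := (Finset.card_filter_le (links j) fun g => ∀ z ∈ Ω, |g z| ≤ a (j + 1)).trans
          (Finset.card_image_le.trans (Finset.card_product _ _).le)
        exact_mod_cast this
      refine h.trans ?_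
      rw [sq]
      exact mul_le_mul ((hScard j).trans (hn j.le_succ)) (hScard _) (by positivity)
        (zero_le_one.trans (hn1 _))
  have hgood := measure_not_forall_abs_empiricalDeviation_le hN hε (G := G) (a := a) (w := w)
    (fun j => by positivity) hw hGm hGb (fun j => (mul_le_mul_of_nonneg_right (hGc j)
      (by positivity)).trans (hcard j))
  -- The nets approximate only on `Ω`, so samples leaving `Ω` are added to the exceptional null set.
  have hae := ae_pi_forall_mem hΩ N
  rw [ae_iff] at hae
  refine (measure_mono ?_).trans ((measure_union_le _ _).trans
    ((add_le_add hgood hae.le).trans (add_zero _).le))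
  intro x hx
  by_contra hcon
  simp only [Set.mem_union, Set.mem_ofPred_eq, not_or, not_not] at hcon
  obtain ⟨hx1, hx2⟩ := hcon
  refine hx fun t => ?_
  choose u huS hu using fun j => hSnet j t
  have hchain : ∀ K, |empiricalDeviation ρ x (f (u K))| ≤
      ∑ j ∈ Finset.range (K + 1), a j * w j / √(N : ℝ) := by
    intro K
    induction K with
    | zero => simpa using hx1 0 (f (u 0)) (Finset.mem_image_of_mem _ (huS 0))
    | succ K ih =>
      rw [Finset.sum_range_succ]
      have hmem : (fun z => f (u (K + 1)) z - f (u K) z) ∈ G (K + 1) := by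
        refine Finset.mem_filter.mpr ⟨Finset.mem_image.mpr ⟨(u K, u (K + 1)),
          Finset.mem_product.mpr ⟨huS _, huS _⟩, rfl⟩, fun z hz => ?_⟩
        have h1 := hu K z hz
        have h2 := hu (K + 1) z hz
        have h3 : a (K + 1) = 2 * (D / 2 ^ K) := by
          simp only [a, pow_succ]; field_simp; norm_num
        have h4 : D / 2 ^ (K + 1) ≤ D / 2 ^ K :=
          div_le_div_of_nonneg_left hD.le (by positivity)
            (pow_le_pow_right₀ (by norm_num) K.le_succ)
        rw [h3]
        rw [abs_le] at *
        constructor <;> linarith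
      have h := hx1 (K + 1) _ hmem
      rw [empiricalDeviation_sub x (hint _) (hint _)] at h
      calc |empiricalDeviation ρ x (f (u (K + 1)))|
          = |empiricalDeviation ρ x (f (u K)) + (empiricalDeviation ρ x (f (u (K + 1))) -
              empiricalDeviation ρ x (f (u K)))| := by congr 1; ring
        _ ≤ _ := (abs_add_le _ _).trans (add_le_add ih h)
  have hfin : ∀ K : ℕ, |empiricalDeviation ρ x (f t)| ≤ V + 2 * (D / 2 ^ K) := by
    intro K
    have h1 := abs_empiricalDeviation_le hN x (g := fun z => f t z - f (u K) z)
      (haeΩ.mono fun z hz => hu K z hz) (fun i => hu K _ (hx2 i))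
    rw [empiricalDeviation_sub x (hint _) (hint _)] at h1
    have h2 := (hchain K).trans (hV (K + 1))
    calc |empiricalDeviation ρ x (f t)| = |empiricalDeviation ρ x (f (u K)) +
          (empiricalDeviation ρ x (f t) - empiricalDeviation ρ x (f (u K)))| := by congr 1; ring
      _ ≤ _ := (abs_add_le _ _).trans (add_le_add h2 h1)
  -- The error of stopping the chain at level `K` is deterministic and vanishes as `K` grows, so
  -- uncountably many `t` are covered by countably many events.
  have hlim : Tendsto (fun K : ℕ => V + 2 * (D / 2 ^ K)) atTop (𝓝 (V + 2 * 0)) := by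
    refine tendsto_const_nhds.add (Tendsto.const_mul 2 ?_)
    simpa [div_eq_mul_inv] using
      (tendsto_pow_atTop_nhds_zero_of_lt_one (r := (2 : ℝ)⁻¹) (by norm_num)
        (by norm_num)).const_mul D
  simpa using ge_of_tendsto' hlim hfin

end Deviation

/-! ### Finite nets of parameter cubes -/

theorem card_Icc_floor_le {r s : ℝ} (hr : 0 ≤ r) (hs : 0 < s) :
    ((Finset.Icc ⌊-r / s⌋ ⌊r / s⌋).card : ℝ) ≤ 2 * r / s + 2 := by
  have h1 : -r / s ≤ r / s := by gcongr; linarith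
  have h2 : ⌊-r / s⌋ ≤ ⌊r / s⌋ := Int.floor_le_floor h1
  have h3 : (((⌊r / s⌋ + 1 - ⌊-r / s⌋).toNat : ℤ) : ℝ) = ⌊r / s⌋ + 1 - ⌊-r / s⌋ := by
    rw [Int.toNat_of_nonneg (by omega)]; push_cast; ring
  rw [Int.card_Icc, ← Int.cast_natCast, h3]
  have h4 := Int.floor_le (r / s)
  have h5 := (Int.sub_one_lt_floor (-r / s)).le
  have h6 : 2 * r / s + 2 = r / s + 1 - (-r / s - 1) := by ring
  linarith

/-- A finite net, in the sup norm, of a family of parameters contained in a cube. -/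
theorem exists_finset_net {T ι : Type*} [Fintype ι] (e : T → ι → ℝ) {r s : ℝ} (hr : 0 ≤ r)
    (hs : 0 < s) (he : ∀ t i, |e t i| ≤ r) :
    ∃ S : Finset T, (S.card : ℝ) ≤ (2 * r / s + 2) ^ Fintype.card ι ∧
      ∀ t, ∃ u ∈ S, ∀ i, |e t i - e u i| ≤ s := by
  classical
  rcases isEmpty_or_nonempty T with hT | hT
  · exact ⟨∅, by simpa using by positivity, fun t => hT.elim t⟩
  -- One representative is taken from each occupied grid cell. The net then lies in `T` itself, even
  -- when constraints on the parameters exclude the grid points.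
  let cell : T → ι → ℤ := fun t i => ⌊e t i / s⌋
  let box : Finset (ι → ℤ) := Fintype.piFinset fun _ => Finset.Icc ⌊-r / s⌋ ⌊r / s⌋
  have hcell : ∀ t, cell t ∈ box := by
    intro t
    rw [Fintype.mem_piFinset]
    intro i
    have h := abs_le.mp (he t i)
    rw [Finset.mem_Icc]
    exact ⟨Int.floor_le_floor (by gcongr; exact h.1), Int.floor_le_floor (by gcongr; exact h.2)⟩
  refine ⟨box.image (Function.invFun cell), ?_, fun t => ⟨Function.invFun cell (cell t),
    Finset.mem_image_of_mem _ (hcell t), fun i => ?_⟩⟩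
  · have h1 : ((box.image (Function.invFun cell)).card : ℝ) ≤ box.card := by
      exact_mod_cast Finset.card_image_le
    refine h1.trans ?_
    rw [Fintype.card_piFinset, Finset.prod_const, Finset.card_univ]
    push_cast
    gcongr
    exact card_Icc_floor_le hr hs
  · have h1 : cell (Function.invFun cell (cell t)) = cell t := Function.invFun_eq ⟨t, rfl⟩
    have h2 := Int.abs_sub_lt_one_of_floor_eq_floor (congrFun h1 i)
    rw [← sub_div, abs_div, abs_of_pos hs, div_lt_one hs, abs_sub_comm] at h2
    exact h2.le

/-! ### Weights of the chaining and the Lipschitz deviation bound -/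

theorem sum_range_one_div_two_pow_le (K : ℕ) : ∑ j ∈ Finset.range K, (1 : ℝ) / 2 ^ j ≤ 2 := by
  have h : ∑ j ∈ Finset.range K, (1 : ℝ) / 2 ^ j = 2 - 2 / 2 ^ K := by
    induction K with
    | zero => simp
    | succ K ih => rw [Finset.sum_range_succ, ih, pow_succ]; field_simp; ring
  have : (0 : ℝ) ≤ 2 / 2 ^ K := by positivity
  linarith

theorem sum_range_add_two_div_two_pow_le (K : ℕ) :
    ∑ j ∈ Finset.range K, ((j : ℝ) + 2) / 2 ^ j ≤ 6 := by
  have h : ∑ j ∈ Finset.range K, ((j : ℝ) + 2) / 2 ^ j = 6 - (2 * K + 6) / 2 ^ K := by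
    induction K with
    | zero => norm_num
    | succ K ih => rw [Finset.sum_range_succ, ih, pow_succ]; push_cast; field_simp; ring
  have : (0 : ℝ) ≤ (2 * K + 6) / 2 ^ K := by positivity
  linarith

theorem sqrt_add_le_sqrt_add_sqrt (a b : ℝ) : √(a + b) ≤ √a + √b := by
  have h : ∀ c : ℝ, c ≤ √c ^ 2 := fun c => by
    rcases le_total 0 c with hc | hc
    · exact (Real.sq_sqrt hc).ge
    · exact hc.trans (sq_nonneg _)
  have h0 := mul_nonneg (Real.sqrt_nonneg a) (Real.sqrt_nonneg b)
  rw [Real.sqrt_le_iff]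
  exact ⟨by positivity, by nlinarith [h a, h b]⟩

theorem two_pow_le_exp (k : ℕ) : (2 : ℝ) ^ k ≤ Real.exp k := by
  have h : (2 : ℝ) ≤ Real.exp 1 := by have := Real.add_one_le_exp (1 : ℝ); linarith
  calc (2 : ℝ) ^ k ≤ Real.exp 1 ^ k := by gcongr
    _ = Real.exp k := by rw [← Real.exp_nat_mul, mul_one]

/-- The multiple of the standard deviation allowed at the dyadic scale `j` of the chaining. -/
noncomputable def chainingWeight (p : ℕ) (H ε : ℝ) (j : ℕ) : ℝ :=
  √(4 * (p * Real.log H) + (4 * p + 2) * (j + 2) + 2 * Real.log (1 / ε))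

/-- Half the squared weight is `2 * p * (log H + j + 2) + (j + 2) + log (1 / ε)`. The first part
cancels the squared net cardinality, the second makes the failure probabilities summable over
scales, and the third supplies the factor `ε`. -/
theorem net_card_mul_exp_chainingWeight_le {p : ℕ} {H ε : ℝ} (hH : 1 ≤ H) (hε : 0 < ε)
    (hε1 : ε < 1) (j : ℕ) :
    ((4 * H * 2 ^ j) ^ p) ^ 2 * (2 * Real.exp (-chainingWeight p H ε j ^ 2 / 2)) ≤
      ε / 2 / 2 ^ j := by
  have hlH : 0 ≤ Real.log H := Real.log_nonneg hH
  have hle : 0 ≤ Real.log (1 / ε) := Real.log_nonneg (by rw [le_div_iff₀ hε]; linarith)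
  have h1 : 4 * H * 2 ^ j ≤ Real.exp (Real.log H + (j + 2)) := by
    rw [Real.exp_add, Real.exp_log (by linarith)]
    have := two_pow_le_exp (j + 2)
    push_cast at this
    calc 4 * H * 2 ^ j = H * 2 ^ (j + 2) := by ring
      _ ≤ _ := by gcongr
  have h2 : ((4 * H * 2 ^ j) ^ p) ^ 2 ≤ Real.exp (2 * p * (Real.log H + (j + 2))) := by
    calc ((4 * H * 2 ^ j) ^ p) ^ 2 = (4 * H * 2 ^ j) ^ (2 * p) := by ring
      _ ≤ Real.exp (Real.log H + (j + 2)) ^ (2 * p) := by gcongr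
      _ = _ := by rw [← Real.exp_nat_mul]; push_cast; rfl
  have h3 : Real.exp (-((j : ℝ) + 2)) ≤ 1 / 2 ^ (j + 2) := by
    rw [Real.exp_neg, one_div]
    have := two_pow_le_exp (j + 2)
    push_cast at this
    gcongr
  rw [chainingWeight, Real.sq_sqrt (by positivity)]
  calc _ ≤ Real.exp (2 * p * (Real.log H + (j + 2))) * (2 * Real.exp
        (-(4 * (p * Real.log H) + (4 * p + 2) * (j + 2) + 2 * Real.log (1 / ε)) / 2)) := by gcongr
    _ = 2 * Real.exp (-((j : ℝ) + 2)) * Real.exp (Real.log ε) := by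
        rw [mul_left_comm, ← Real.exp_add, mul_assoc (2 : ℝ) (Real.exp _), ← Real.exp_add, one_div, Real.log_inv]
        congr 2
        ring
    _ ≤ 2 * (1 / 2 ^ (j + 2)) * ε := by rw [Real.exp_log hε]; gcongr
    _ = ε / 2 / 2 ^ j := by rw [pow_add]; field_simp

/-- Subadditivity of the square root and `√(j + 2) ≤ j + 2` leave a bound affine in `j`, whose sum
against `1 / 2 ^ j` is explicit. -/
theorem chainingWeight_le {p : ℕ} (hp : 1 ≤ p) {H ε : ℝ} (j : ℕ) :
    chainingWeight p H ε j ≤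
      2 * √(p * Real.log H) + √(6 * p) * (j + 2) + √(2 * Real.log (1 / ε)) := by
  have hp' : (1 : ℝ) ≤ p := by exact_mod_cast hp
  have hj : (0 : ℝ) ≤ j := by positivity
  have h1 : √(4 * (p * Real.log H)) = 2 * √(p * Real.log H) := by
    rw [Real.sqrt_mul (by norm_num)]
    congr 1
    rw [show (4 : ℝ) = 2 ^ 2 by norm_num, Real.sqrt_sq (by norm_num)]
  have h2 : √((4 * p + 2) * ((j : ℝ) + 2)) ≤ √(6 * p) * (j + 2) := by
    rw [← Real.sqrt_sq (show (0 : ℝ) ≤ j + 2 by positivity),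
      ← Real.sqrt_mul (show (0 : ℝ) ≤ 6 * p by positivity)]
    apply Real.sqrt_le_sqrt
    rw [Real.sqrt_sq (by positivity)]
    have : ((j : ℝ) + 2) ≤ (j + 2) ^ 2 := by nlinarith
    exact mul_le_mul (by linarith) this (by positivity) (by positivity)
  rw [← h1]
  exact (sqrt_add_le_sqrt_add_sqrt _ _).trans (add_le_add_left
    ((sqrt_add_le_sqrt_add_sqrt _ _).trans (add_le_add_right h2 _)) _)

/-- Uniform deviation bound for a bounded family of functions that is Lipschitz in finitely many
bounded real parameters. -/
theorem measure_not_forall_abs_empiricalDeviation_le_of_lipschitz {X : Type*} [MeasurableSpace X]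
    {ρ : Measure X} [IsProbabilityMeasure ρ] {N : ℕ} (hN : 0 < N) {T ι : Type*} [Fintype ι]
    [Nonempty ι] (e : T → ι → ℝ) {f : T → X → ℝ} {Ω : Set X} {D L H r ε : ℝ}
    (hΩ : ρ Ωᶜ = 0) (hε : 0 < ε) (hε1 : ε < 1) (hD : 0 < D) (hL : 0 < L) (hH : 1 ≤ H)
    (hr : 0 ≤ r) (hrL : r * L ≤ D * H) (he : ∀ t i, |e t i| ≤ r)
    (hf : ∀ t, AEMeasurable (f t) ρ) (hb : ∀ t, ∀ x ∈ Ω, |f t x| ≤ D)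
    (hlip : ∀ t u δ, 0 ≤ δ → (∀ i, |e t i - e u i| ≤ δ) → ∀ x ∈ Ω, |f t x - f u x| ≤ L * δ) :
    Measure.pi (fun _ : Fin N => ρ) {x | ¬ ∀ t, |empiricalDeviation ρ x (f t)| ≤
      4 * D / √(N : ℝ) * (4 * √(Fintype.card ι * Real.log H) + 6 * √(6 * Fintype.card ι) +
        2 * √(2 * Real.log (1 / ε)))} ≤ ENNReal.ofReal ε := by
  set p := Fintype.card ι
  have hp : 1 ≤ p := Fintype.card_pos
  have hbase : ∀ j : ℕ, 1 ≤ 4 * H * 2 ^ j := fun j => by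
    have : (1 : ℝ) ≤ 2 ^ j := one_le_pow₀ (by norm_num)
    nlinarith
  refine measure_not_forall_abs_empiricalDeviation_le_of_nets hN
    (n := fun j => (4 * H * 2 ^ j) ^ p) (w := chainingWeight p H ε) hΩ hε.le hD
    (fun j => Real.sqrt_nonneg _) ?_ (fun j => one_le_pow₀ (hbase j)) hf hb ?_
    (net_card_mul_exp_chainingWeight_le hH hε hε1) ?_
  · intro i j hij
    have : (2 : ℝ) ^ i ≤ 2 ^ j := pow_le_pow_right₀ (by norm_num) hij
    have h0 : 0 ≤ H := by linarith
    dsimp only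
    gcongr
  · intro j
    -- The mesh is chosen so that `L` times it equals `D / 2 ^ j`.
    obtain ⟨S, hS, hnet⟩ := exists_finset_net e hr (s := D / (L * 2 ^ j)) (by positivity) he
    refine ⟨S, hS.trans ?_, fun t => ?_⟩
    · have h1 : 2 * r / (D / (L * 2 ^ j)) = 2 * 2 ^ j * (r * L) / D := by field_simp
      have h2 : 2 * 2 ^ j * (r * L) / D ≤ 2 * H * 2 ^ j := by
        rw [div_le_iff₀ hD]
        calc 2 * 2 ^ j * (r * L) ≤ 2 * 2 ^ j * (D * H) := by gcongr
          _ = _ := by ring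
      have h3 : (1 : ℝ) ≤ 2 ^ j := one_le_pow₀ (by norm_num)
      have h4 : 2 ≤ 2 * H * 2 ^ j := by nlinarith
      apply pow_le_pow_left₀ (by positivity)
      linarith
    · obtain ⟨u, hu, h⟩ := hnet t
      refine ⟨u, hu, fun x hx => (hlip t u _ (by positivity) h x hx).trans (le_of_eq ?_)⟩
      field_simp
  · intro K
    set A := 2 * √(p * Real.log H) + √(2 * Real.log (1 / ε))
    calc ∑ j ∈ Finset.range K, 4 * D / 2 ^ j * chainingWeight p H ε j / √(N : ℝ)
        ≤ ∑ j ∈ Finset.range K, 4 * D / √(N : ℝ) *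
            (A * (1 / 2 ^ j) + √(6 * p) * (((j : ℝ) + 2) / 2 ^ j)) := by
          refine Finset.sum_le_sum fun j _ => ?_
          calc 4 * D / 2 ^ j * chainingWeight p H ε j / √(N : ℝ)
              ≤ 4 * D / 2 ^ j * (2 * √(p * Real.log H) + √(6 * p) * (j + 2) +
                √(2 * Real.log (1 / ε))) / √(N : ℝ) := by gcongr; exact chainingWeight_le hp j
            _ = _ := by simp only [A]; field_simp; ring
      _ = 4 * D / √(N : ℝ) * (A * ∑ j ∈ Finset.range K, (1 : ℝ) / 2 ^ j +
            √(6 * p) * ∑ j ∈ Finset.range K, ((j : ℝ) + 2) / 2 ^ j) := by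
          rw [← Finset.mul_sum, Finset.sum_add_distrib, Finset.mul_sum, Finset.mul_sum]
      _ ≤ 4 * D / √(N : ℝ) * (A * 2 + √(6 * p) * 6) := by
          have := sum_range_one_div_two_pow_le K
          have := sum_range_add_two_div_two_pow_le K
          gcongr
      _ = _ := by simp only [A]; ring

/-! ### Estimates for SoftPlus and the sigmoid -/

section Softplus

theorem hasDerivAt_softplus {τ : ℝ} (hτ : τ ≠ 0) (z : ℝ) :
    HasDerivAt (softplus τ) (Real.sigmoid (τ * z)) z := by
  have h1 : HasDerivAt (fun z => 1 + Real.exp (τ * z)) (Real.exp (τ * z) * (τ * 1)) z :=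
    (((hasDerivAt_id z).const_mul τ).exp).const_add 1
  have h2 := (h1.log (by positivity)).const_mul (1 / τ)
  refine h2.congr_deriv ?_
  rw [Real.sigmoid_def, Real.exp_neg]
  field_simp
  ring

theorem abs_softplus_sub_le {τ : ℝ} (hτ : τ ≠ 0) (z z' : ℝ) :
    |softplus τ z - softplus τ z'| ≤ |z - z'| := by
  have h := Convex.norm_image_sub_le_of_norm_hasDerivWithin_le (f := softplus τ) (C := 1)
    (s := Set.univ) (x := z') (y := z) (fun x _ => (hasDerivAt_softplus hτ x).hasDerivWithinAt)
    (fun x _ => by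
      rw [Real.norm_eq_abs, abs_of_nonneg (Real.sigmoid_nonneg _)]
      exact Real.sigmoid_le_one _) convex_univ trivial trivial
  simpa using h

theorem abs_sigmoid_sub_le (z z' : ℝ) : |Real.sigmoid z - Real.sigmoid z'| ≤ |z - z'| := by
  have h := Convex.norm_image_sub_le_of_norm_hasDerivWithin_le (f := Real.sigmoid) (C := 1)
    (s := Set.univ) (x := z') (y := z) (fun x _ => (Real.hasDerivAt_sigmoid x).hasDerivWithinAt)
    (fun x _ => by
      have h1 := Real.sigmoid_nonneg x
      have h2 := Real.sigmoid_le_one x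
      rw [Real.norm_eq_abs, abs_of_nonneg (by nlinarith)]
      nlinarith) convex_univ trivial trivial
  simpa using h

theorem abs_softplus_le {τ : ℝ} (hτ : 0 < τ) (z : ℝ) : |softplus τ z| ≤ |z| + 1 / τ := by
  have h0 : 0 < Real.exp (τ * z) := Real.exp_pos _
  have h1 : 0 ≤ Real.log (1 + Real.exp (τ * z)) := Real.log_nonneg (by linarith)
  -- With `u = τ * |z|`, this is `1 + exp (τ * z) ≤ 2 * exp u ≤ exp (u + 1)`.
  have h2 : Real.log (1 + Real.exp (τ * z)) ≤ τ * |z| + 1 := by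
    rw [Real.log_le_iff_le_exp (by positivity), Real.exp_add]
    have h3 : Real.exp (τ * z) ≤ Real.exp (τ * |z|) := by
      apply Real.exp_le_exp.mpr; gcongr; exact le_abs_self z
    have h4 : 1 ≤ Real.exp (τ * |z|) := Real.one_le_exp (by positivity)
    have h5 := Real.add_one_le_exp (1 : ℝ)
    nlinarith
  rw [softplus, abs_of_nonneg (by positivity)]
  calc 1 / τ * Real.log (1 + Real.exp (τ * z)) ≤ 1 / τ * (τ * |z| + 1) := by gcongr
    _ = |z| + 1 / τ := by field_simp

end Softplus

/-! ### Networks as functions of their parameters -/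

/-- The parameters of the two-layer networks in the class `networkClass σ d m B`. -/
structure NetworkParam (d m : ℕ) (B : ℝ) where
  bias : ℝ
  outer : Fin m → ℝ
  shift : Fin m → ℝ
  weight : Fin m → EuclideanSpace ℝ (Fin d)
  abs_bias_le : |bias| ≤ 2 * B
  abs_outer_le : ∀ k, |outer k| ≤ 16 * B
  sum_abs_weight : ∀ k, ∑ i, |weight k i| = 1
  abs_shift_le : ∀ k, |shift k| ≤ 1

namespace NetworkParam

variable {d m : ℕ} {B : ℝ}

/-- The parameters as a vector of `m * (d + 2) + 1` real numbers. -/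
def coord (θ : NetworkParam d m B) : Option (Fin m × Option (Option (Fin d))) → ℝ
  | none => θ.bias
  | some (k, none) => θ.outer k
  | some (k, some none) => θ.shift k
  | some (k, some (some i)) => θ.weight k i

/-- The argument of the activation of the `k`-th neuron. -/
noncomputable def preact (θ : NetworkParam d m B) (k : Fin m) (x : EuclideanSpace ℝ (Fin d)) : ℝ :=
  inner ℝ (θ.weight k) x + θ.shift k

/-- The SoftPlus network with the given parameters. -/
noncomputable def eval (τ : ℝ) (θ : NetworkParam d m B) (x : EuclideanSpace ℝ (Fin d)) : ℝ :=
  θ.bias + 1 / (m : ℝ) * ∑ k, θ.outer k * softplus τ (θ.preact k x)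

/-- The gradient of the SoftPlus network with the given parameters. -/
noncomputable def grad (τ : ℝ) (θ : NetworkParam d m B) (x : EuclideanSpace ℝ (Fin d)) :
    EuclideanSpace ℝ (Fin d) :=
  (1 / (m : ℝ)) • ∑ k, (θ.outer k * Real.sigmoid (τ * θ.preact k x)) • θ.weight k

theorem exists_eval_eq {τ : ℝ} {φ : EuclideanSpace ℝ (Fin d) → ℝ}
    (h : φ ∈ networkClass (softplus τ) d m B) : ∃ θ : NetworkParam d m B, φ = θ.eval τ := by
  obtain ⟨c, a, b, w, hc, ha, hw, hb, rfl⟩ := h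
  exact ⟨⟨c, a, b, w, hc, ha, hw, hb⟩, rfl⟩

theorem hasGradientAt_eval {τ : ℝ} (hτ : τ ≠ 0) (θ : NetworkParam d m B)
    (x : EuclideanSpace ℝ (Fin d)) : HasGradientAt (θ.eval τ) (θ.grad τ x) x := by
  rw [hasGradientAt_iff_hasFDerivAt]
  have h1 : ∀ k, HasFDerivAt (fun x => θ.outer k * softplus τ (θ.preact k x))
      (θ.outer k • Real.sigmoid (τ * θ.preact k x) • innerSL ℝ (θ.weight k)) x := by
    intro k
    have h2 : HasFDerivAt (θ.preact k) (innerSL ℝ (θ.weight k)) x :=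
      ((innerSL ℝ (θ.weight k)).hasFDerivAt (x := x)).add_const (θ.shift k)
    exact ((hasDerivAt_softplus hτ (θ.preact k x)).comp_hasFDerivAt x h2).const_mul _
  have h3 := ((HasFDerivAt.fun_sum fun k (_ : k ∈ Finset.univ) => h1 k).const_mul
    (1 / (m : ℝ))).const_add θ.bias
  refine h3.congr_fderiv ?_
  ext v
  simp [grad, InnerProductSpace.toDual_apply_apply, mul_assoc]

theorem gradient_eval {τ : ℝ} (hτ : τ ≠ 0) (θ : NetworkParam d m B) :
    gradient (θ.eval τ) = θ.grad τ :=
  gradient_eq (θ.hasGradientAt_eval hτ)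

theorem continuous_eval {τ : ℝ} (hτ : τ ≠ 0) (θ : NetworkParam d m B) :
    Continuous (θ.eval τ) :=
  continuous_iff_continuousAt.mpr fun x =>
    (θ.hasGradientAt_eval hτ x).differentiableAt.continuousAt

theorem continuous_grad (τ : ℝ) (θ : NetworkParam d m B) : Continuous (θ.grad τ) := by
  unfold grad preact
  have := continuous_sigmoid
  fun_prop

theorem abs_coord_le (hB : 0 ≤ B) (θ : NetworkParam d m B)
    (j : Option (Fin m × Option (Option (Fin d)))) : |θ.coord j| ≤ 16 * B + 1 := by
  rcases j with _ | ⟨k, _ | _ | i⟩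
  · exact θ.abs_bias_le.trans (by linarith)
  · exact (θ.abs_outer_le k).trans (by linarith)
  · exact (θ.abs_shift_le k).trans (by linarith)
  · have h := Finset.single_le_sum (f := fun i => |θ.weight k i|) (fun i _ => abs_nonneg _)
      (Finset.mem_univ i)
    rw [θ.sum_abs_weight k] at h
    exact h.trans (by linarith)

theorem _root_.EuclideanSpace.norm_le_sum_abs {d : ℕ} (v : EuclideanSpace ℝ (Fin d)) :
    ‖v‖ ≤ ∑ i, |v i| := by
  rw [EuclideanSpace.norm_eq]
  refine Real.sqrt_le_iff.mpr ⟨by positivity, ?_⟩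
  simpa using Finset.sum_sq_le_sq_sum_of_nonneg (s := Finset.univ) (f := fun i => |v i|)
    fun i _ => abs_nonneg _

theorem _root_.EuclideanSpace.abs_inner_le_sum_abs_mul {d : ℕ} (v x : EuclideanSpace ℝ (Fin d))
    {R : ℝ} (hx : ∀ i, |x i| ≤ R) : |inner ℝ v x| ≤ (∑ i, |v i|) * R := by
  rw [PiLp.inner_apply, Finset.sum_mul]
  refine (Finset.abs_sum_le_sum_abs _ _).trans (Finset.sum_le_sum fun i _ => ?_)
  have h : |inner ℝ (v i) (x i)| = |v i| * |x i| := by simp [abs_mul, mul_comm]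
  rw [h]
  exact mul_le_mul_of_nonneg_left (hx i) (abs_nonneg _)

theorem norm_weight_le (θ : NetworkParam d m B) (k : Fin m) : ‖θ.weight k‖ ≤ 1 :=
  (EuclideanSpace.norm_le_sum_abs _).trans (θ.sum_abs_weight k).le

variable {R : ℝ} {x : EuclideanSpace ℝ (Fin d)}

theorem abs_preact_le (θ : NetworkParam d m B) (k : Fin m) (hx : ∀ i, |x i| ≤ R) :
    |θ.preact k x| ≤ R + 1 := by
  have h := EuclideanSpace.abs_inner_le_sum_abs_mul (θ.weight k) x hx
  rw [θ.sum_abs_weight k, one_mul] at h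
  exact (abs_add_le _ _).trans (add_le_add h (θ.abs_shift_le k))

theorem norm_average_le {E : Type*} [SeminormedAddCommGroup E] [NormedSpace ℝ E] (hm : 0 < m)
    {v : Fin m → E} {C : ℝ} (h : ∀ k, ‖v k‖ ≤ C) : ‖(1 / (m : ℝ)) • ∑ k, v k‖ ≤ C := by
  have hm' : (0 : ℝ) < m := by exact_mod_cast hm
  rw [norm_smul, Real.norm_of_nonneg (by positivity), one_div, inv_mul_le_iff₀ hm']
  calc ‖∑ k, v k‖ ≤ ∑ k, ‖v k‖ := norm_sum_le _ _
    _ ≤ ∑ _k : Fin m, C := Finset.sum_le_sum fun k _ => h k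
    _ = m * C := by simp

/-- The lower bound on `τ` enters here: SoftPlus exceeds `|z|` by at most `1 / τ ≤ κ`. -/
theorem abs_softplus_preact_le {κ τ : ℝ} (hκ : 1 ≤ κ) (hτ : 1 / κ ≤ τ)
    (θ : NetworkParam d m B) (k : Fin m) (hx : ∀ i, |x i| ≤ R) :
    |softplus τ (θ.preact k x)| ≤ R + 1 + κ := by
  have hτ0 : 0 < τ := lt_of_lt_of_le (by positivity) hτ
  have h : 1 / τ ≤ κ := by
    rw [div_le_iff₀ hτ0]
    rwa [div_le_iff₀ (by linarith), mul_comm] at hτ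
  exact (abs_softplus_le hτ0 _).trans (add_le_add (θ.abs_preact_le k hx) h)

theorem abs_eval_le {κ τ : ℝ} (hR : 0 < R) (hκ : 1 ≤ κ) (hτ : 1 / κ ≤ τ) (hm : 0 < m)
    (hB : 0 ≤ B) (θ : NetworkParam d m B) (hx : ∀ i, |x i| ≤ R) :
    |θ.eval τ x| ≤ 2 * B + 16 * B * (R + 1 + κ) := by
  refine (abs_add_le _ _).trans (add_le_add θ.abs_bias_le ?_)
  refine norm_average_le (E := ℝ) hm fun k => ?_
  rw [Real.norm_eq_abs, abs_mul]
  exact mul_le_mul (θ.abs_outer_le k) (θ.abs_softplus_preact_le hκ hτ k hx) (abs_nonneg _)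
    (by positivity)

theorem norm_grad_le {τ : ℝ} (hm : 0 < m) (hB : 0 ≤ B) (θ : NetworkParam d m B) :
    ‖θ.grad τ x‖ ≤ 16 * B := by
  refine norm_average_le hm fun k => ?_
  rw [norm_smul, norm_mul, Real.norm_eq_abs, Real.norm_of_nonneg (Real.sigmoid_nonneg _)]
  calc |θ.outer k| * Real.sigmoid (τ * θ.preact k x) * ‖θ.weight k‖ ≤ 16 * B * 1 * 1 := by
        gcongr
        · exact Real.sigmoid_nonneg _
        · exact θ.abs_outer_le k
        · exact Real.sigmoid_le_one _
        · exact θ.norm_weight_le k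
    _ = 16 * B := by ring

variable {θ θ' : NetworkParam d m B} {δ : ℝ}

theorem sum_abs_weight_sub_le (h : ∀ j, |θ.coord j - θ'.coord j| ≤ δ) (k : Fin m) :
    ∑ i, |(θ.weight k - θ'.weight k) i| ≤ d * δ := by
  calc ∑ i, |(θ.weight k - θ'.weight k) i| ≤ ∑ _i : Fin d, δ :=
        Finset.sum_le_sum fun i _ => h (some (k, some (some i)))
    _ = d * δ := by simp

theorem abs_preact_sub_le (h : ∀ j, |θ.coord j - θ'.coord j| ≤ δ) (hR : 0 < R)
    (hx : ∀ i, |x i| ≤ R) (k : Fin m) :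
    |θ.preact k x - θ'.preact k x| ≤ (d * R + 1) * δ := by
  have h1 : θ.preact k x - θ'.preact k x =
      inner ℝ (θ.weight k - θ'.weight k) x + (θ.shift k - θ'.shift k) := by
    simp only [preact, inner_sub_left]; ring
  have h2 := EuclideanSpace.abs_inner_le_sum_abs_mul (θ.weight k - θ'.weight k) x hx
  have h3 := mul_le_mul_of_nonneg_right (sum_abs_weight_sub_le h k) hR.le
  have h4 : |θ.shift k - θ'.shift k| ≤ δ := h (some (k, some none))
  rw [h1]
  refine (abs_add_le _ _).trans ?_
  linarith

/-- Averaging over neurons cancels the sum over `k`, and SoftPlus is 1-Lipschitz for every `τ`;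
hence the constant involves neither `m` nor `τ`. -/
theorem abs_eval_sub_le {κ τ : ℝ} (hR : 0 < R) (hκ : 1 ≤ κ) (hτ : 1 / κ ≤ τ) (hm : 0 < m)
    (hB : 0 ≤ B) (h : ∀ j, |θ.coord j - θ'.coord j| ≤ δ) (hx : ∀ i, |x i| ≤ R) :
    |θ.eval τ x - θ'.eval τ x| ≤ (1 + (R + 1 + κ) + 16 * B * (d * R + 1)) * δ := by
  have hδ : 0 ≤ δ := (abs_nonneg _).trans (h none)
  have hτ0 : 0 < τ := lt_of_lt_of_le (by positivity) hτ
  have h1 : θ.eval τ x - θ'.eval τ x = (θ.bias - θ'.bias) + (1 / (m : ℝ)) •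
      ∑ k, (θ.outer k * softplus τ (θ.preact k x) - θ'.outer k * softplus τ (θ'.preact k x)) := by
    simp only [eval, Finset.sum_sub_distrib, smul_eq_mul]; ring
  have h2 : |θ.bias - θ'.bias| ≤ δ := h none
  have h3 := norm_average_le hm (C := (R + 1 + κ + 16 * B * (d * R + 1)) * δ)
    (v := fun k => θ.outer k * softplus τ (θ.preact k x) -
      θ'.outer k * softplus τ (θ'.preact k x)) fun k => by
    have e : θ.outer k * softplus τ (θ.preact k x) - θ'.outer k * softplus τ (θ'.preact k x) =
        (θ.outer k - θ'.outer k) * softplus τ (θ.preact k x) +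
        θ'.outer k * (softplus τ (θ.preact k x) - softplus τ (θ'.preact k x)) := by ring
    have h4 : |θ.outer k - θ'.outer k| ≤ δ := h (some (k, none))
    rw [Real.norm_eq_abs, e]
    calc _ ≤ |θ.outer k - θ'.outer k| * |softplus τ (θ.preact k x)| +
          |θ'.outer k| * |softplus τ (θ.preact k x) - softplus τ (θ'.preact k x)| := by
          rw [← abs_mul, ← abs_mul]; exact abs_add_le _ _
      _ ≤ δ * (R + 1 + κ) + 16 * B * ((d * R + 1) * δ) := by
          gcongr
          · exact θ.abs_softplus_preact_le hκ hτ k hx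
          · exact θ'.abs_outer_le k
          · exact (abs_softplus_sub_le hτ0.ne' _ _).trans (abs_preact_sub_le h hR hx k)
      _ = _ := by ring
  rw [h1]
  refine (abs_add_le _ _).trans ?_
  rw [Real.norm_eq_abs] at h3
  linarith

/-- The only source of `√m` is the slope of `z ↦ sigmoid (τ * z)`, at most `τ ≤ κ * √m`. The other
terms of the product rule are enlarged using `1 ≤ √m`. -/
theorem norm_grad_sub_le {κ τ : ℝ} (hR : 0 < R) (hκ : 1 ≤ κ) (hτ0 : 0 < τ)
    (hτ : τ ≤ κ * √(m : ℝ)) (hm : 0 < m)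
    (hB : 0 ≤ B) (h : ∀ j, |θ.coord j - θ'.coord j| ≤ δ) (hx : ∀ i, |x i| ≤ R) :
    ‖θ.grad τ x - θ'.grad τ x‖ ≤ (1 + 16 * B * d + 16 * B * κ * (d * R + 1)) * √(m : ℝ) * δ := by
  have hδ : 0 ≤ δ := (abs_nonneg _).trans (h none)
  have hm1 : 1 ≤ √(m : ℝ) := Real.one_le_sqrt.mpr (by exact_mod_cast hm)
  have h1 : θ.grad τ x - θ'.grad τ x = (1 / (m : ℝ)) •
      ∑ k, ((θ.outer k * Real.sigmoid (τ * θ.preact k x)) • θ.weight k -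
        (θ'.outer k * Real.sigmoid (τ * θ'.preact k x)) • θ'.weight k) := by
    simp only [grad, Finset.sum_sub_distrib, smul_sub]
  rw [h1]
  refine norm_average_le hm fun k => ?_
  set s := Real.sigmoid (τ * θ.preact k x)
  set s' := Real.sigmoid (τ * θ'.preact k x)
  have hs0 : 0 ≤ s := Real.sigmoid_nonneg _
  have hs1 : s ≤ 1 := Real.sigmoid_le_one _
  have hs0' : 0 ≤ s' := Real.sigmoid_nonneg _
  have hs1' : s' ≤ 1 := Real.sigmoid_le_one _
  have hs : |s - s'| ≤ κ * √(m : ℝ) * ((d * R + 1) * δ) := by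
    refine (abs_sigmoid_sub_le _ _).trans ?_
    rw [← mul_sub, abs_mul, abs_of_pos hτ0]
    have := abs_preact_sub_le h hR hx k
    gcongr
  have e : (θ.outer k * s) • θ.weight k - (θ'.outer k * s') • θ'.weight k =
      ((θ.outer k - θ'.outer k) * s) • θ.weight k + ((θ'.outer k * (s - s')) • θ.weight k +
        (θ'.outer k * s') • (θ.weight k - θ'.weight k)) := by
    module
  have h4 : |θ.outer k - θ'.outer k| ≤ δ := h (some (k, none))
  have h5 : ‖θ.weight k - θ'.weight k‖ ≤ d * δ :=
    (EuclideanSpace.norm_le_sum_abs _).trans (sum_abs_weight_sub_le h k)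
  have h6 := θ'.abs_outer_le k
  have h7 := θ.norm_weight_le k
  rw [e]
  calc _ ≤ |θ.outer k - θ'.outer k| * |s| * ‖θ.weight k‖ +
        (|θ'.outer k| * |s - s'| * ‖θ.weight k‖ +
          |θ'.outer k| * |s'| * ‖θ.weight k - θ'.weight k‖) := by
        refine (norm_add_le _ _).trans (add_le_add ?_ ((norm_add_le _ _).trans (add_le_add ?_ ?_)))
          <;> simp [norm_smul]
    _ ≤ δ * 1 * 1 + (16 * B * (κ * √(m : ℝ) * ((d * R + 1) * δ)) * 1 +
          16 * B * 1 * (d * δ)) := by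
        rw [abs_of_nonneg hs0, abs_of_nonneg hs0']
        gcongr
    _ = 1 * (1 + 16 * B * d) * δ + 16 * B * κ * (d * R + 1) * √(m : ℝ) * δ := by ring
    _ ≤ √(m : ℝ) * (1 + 16 * B * d) * δ + 16 * B * κ * (d * R + 1) * √(m : ℝ) * δ := by gcongr
    _ = _ := by ring

end NetworkParam

/-! ### Assembly of the probability bound and its constants -/

/-- Subadditivity alone suffices, so neither set has to be measurable; this matters for events
defined by a supremum over an uncountable class. -/
theorem ofReal_one_sub_le_of_measure_compl_le {X : Type*} [MeasurableSpace X] {P : Measure X}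
    [IsProbabilityMeasure P] {s t : Set X} {ε : ℝ} (h : P t ≤ ENNReal.ofReal ε)
    (hst : ∀ x, x ∉ t → x ∈ s) (hε : 0 ≤ ε) : ENNReal.ofReal (1 - ε) ≤ P s := by
  rw [ENNReal.ofReal_sub _ hε, ENNReal.ofReal_one, tsub_le_iff_right, ← measure_univ (μ := P)]
  refine (measure_mono fun x _ => ?_).trans ((measure_union_le s t).trans (add_le_add_right h _))
  by_cases hx : x ∈ t
  · exact Or.inr hx
  · exact Or.inl (hst x hx)

/-- The constant term of the uniform deviation bound for networks, relative to `√(m / N)`. -/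
noncomputable def entropyConstant (d : ℕ) (h : ℝ) : ℝ :=
  √((d : ℝ) + 3) * (4 * √(Real.log h) + 15) + 4

theorem entropyConstant_nonneg (d : ℕ) (h : ℝ) : 0 ≤ entropyConstant d h := by
  unfold entropyConstant; positivity

/-- The part `ℓ` of `log H` that may grow with `m` is separated from the fixed part `log h`. The `4`
in `entropyConstant` pays for halving `ε`, since `√(2 * log (2 / ε)) ≤ 2 + √(-2 * log ε)`, and `15`
comes from `6 * √6`. -/
theorem chaining_bound_le {d m : ℕ} {p h H ℓ ε : ℝ} (hm : 0 < m) (hp0 : 0 ≤ p)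
    (hp : p ≤ m * (d + 3))
    (hh : 1 ≤ h) (hH : Real.log H ≤ Real.log h + ℓ) (hε : 0 < ε) :
    4 * √(p * Real.log H) + 6 * √(6 * p) + 2 * √(2 * Real.log (1 / (ε / 2))) ≤
      √(m : ℝ) * (entropyConstant d h + 4 * √((d : ℝ) + 3) * √ℓ) +
        2 * √(-2 * Real.log ε) := by
  have hlh : 0 ≤ Real.log h := Real.log_nonneg hh
  have hm1 : 1 ≤ √(m : ℝ) := Real.one_le_sqrt.mpr (by exact_mod_cast hm)
  have hsp : √p ≤ √(m : ℝ) * √((d : ℝ) + 3) := by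
    rw [← Real.sqrt_mul (by positivity)]
    exact Real.sqrt_le_sqrt hp
  have h1 : √(p * Real.log H) ≤ √(m : ℝ) * √((d : ℝ) + 3) * (√(Real.log h) + √ℓ) := by
    rw [Real.sqrt_mul hp0]
    have := (Real.sqrt_le_sqrt hH).trans (sqrt_add_le_sqrt_add_sqrt _ _)
    gcongr
  have h2 : 6 * √(6 * p) ≤ 15 * (√(m : ℝ) * √((d : ℝ) + 3)) := by
    have h6 : √(6 : ℝ) ≤ 5 / 2 := Real.sqrt_le_iff.mpr (by norm_num)
    rw [Real.sqrt_mul (by norm_num)]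
    have := mul_le_mul h6 hsp (Real.sqrt_nonneg _) (by norm_num)
    linarith
  have h3 : √(2 * Real.log (1 / (ε / 2))) ≤ 2 + √(-2 * Real.log ε) := by
    have e : 2 * Real.log (1 / (ε / 2)) = 2 * Real.log 2 + -2 * Real.log ε := by
      rw [one_div_div, Real.log_div (by norm_num) hε.ne']; ring
    have h4 : √(2 * Real.log 2) ≤ 2 :=
      Real.sqrt_le_iff.mpr ⟨by norm_num, by linarith [Real.log_two_lt_d9]⟩
    rw [e]
    exact (sqrt_add_le_sqrt_add_sqrt _ _).trans (add_le_add_left h4 _)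
  unfold entropyConstant
  nlinarith

/-- The bound on the networks in the class of parameter `B` on the cube of half-width `R`. -/
noncomputable def evalBound (R κ B : ℝ) : ℝ := 2 * B + 16 * B * (R + 1 + κ)

/-- The bound on `φ ^ 2 - 2 * φ * y`. -/
noncomputable def fitBound (R κ B Y : ℝ) : ℝ := evalBound R κ B ^ 2 + 2 * evalBound R κ B * Y

/-- The Lipschitz constant of a network in its parameters. -/
noncomputable def evalLip (R κ B : ℝ) (d : ℕ) : ℝ := 1 + (R + 1 + κ) + 16 * B * (d * R + 1)

/-- The Lipschitz constant of `φ ^ 2 - 2 * φ * y` in the parameters of the network `φ`. -/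
noncomputable def fitLip (R κ B : ℝ) (d : ℕ) (Y : ℝ) : ℝ :=
  (2 * evalBound R κ B + 2 * Y) * evalLip R κ B d

/-- The Lipschitz constant, relative to `√m`, of the gradient of a network in its parameters. -/
noncomputable def gradLip (R κ B : ℝ) (d : ℕ) : ℝ := 1 + 16 * B * d + 16 * B * κ * (d * R + 1)

/-- The resolution at which the parameters of a family of functions with bound `D` and Lipschitz
constant `L` have to be known. -/
noncomputable def resolution (B D L : ℝ) : ℝ := 1 + (16 * B + 1) * L / D

theorem one_le_resolution {B D L : ℝ} (hB : 0 < B) (hD : 0 < D) (hL : 0 < L) :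
    1 ≤ resolution B D L := le_add_of_nonneg_right (by positivity)

theorem mul_le_mul_resolution {B D L : ℝ} (hD : 0 < D) :
    (16 * B + 1) * L ≤ D * resolution B D L := by
  rw [resolution, mul_add, mul_div_cancel₀ _ hD.ne']
  linarith

section Constants

variable {R κ B Y : ℝ} {d : ℕ}

theorem evalBound_pos (hR : 0 < R) (hκ : 1 ≤ κ) (hB : 0 < B) : 0 < evalBound R κ B := by
  unfold evalBound; positivity

theorem fitBound_pos (hR : 0 < R) (hκ : 1 ≤ κ) (hB : 0 < B) (hY : 0 < Y) :
    0 < fitBound R κ B Y := by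
  have := evalBound_pos hR hκ hB
  unfold fitBound; positivity

theorem fitLip_pos (hR : 0 < R) (hκ : 1 ≤ κ) (hB : 0 < B) (hY : 0 < Y) :
    0 < fitLip R κ B d Y := by
  have := evalBound_pos hR hκ hB
  unfold fitLip evalLip; positivity

theorem gradLip_pos (hR : 0 < R) (hκ : 1 ≤ κ) (hB : 0 < B) : 0 < gradLip R κ B d := by
  unfold gradLip; positivity

end Constants

/-! ### Uniform deviation of fit plus regularizer -/

namespace NetworkParam

variable {R κ τ B Y : ℝ} {d m : ℕ} {x : EuclideanSpace ℝ (Fin d)}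

theorem abs_fit_le {a b Φ : ℝ} (ha : |a| ≤ Φ) (hb : |b| ≤ Y) :
    |a ^ 2 - 2 * a * b| ≤ Φ ^ 2 + 2 * Φ * Y := by
  have hΦ := (abs_nonneg _).trans ha
  calc |a ^ 2 - 2 * a * b| ≤ |a ^ 2| + |2 * a * b| := abs_sub _ _
    _ = |a| ^ 2 + 2 * |a| * |b| := by simp [abs_mul]
    _ ≤ _ := by gcongr

/-- The difference factors as `(a + a' - 2 * b) * (a - a')`. -/
theorem abs_fit_sub_le {a a' b Φ η : ℝ} (ha : |a| ≤ Φ) (ha' : |a'| ≤ Φ) (hb : |b| ≤ Y)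
    (h : |a - a'| ≤ η) :
    |(a ^ 2 - 2 * a * b) - (a' ^ 2 - 2 * a' * b)| ≤ (2 * Φ + 2 * Y) * η := by
  have hΦ := (abs_nonneg _).trans ha
  have hY := (abs_nonneg _).trans hb
  have e : (a ^ 2 - 2 * a * b) - (a' ^ 2 - 2 * a' * b) = (a + a' - 2 * b) * (a - a') := by ring
  have h1 : |a + a' - 2 * b| ≤ 2 * Φ + 2 * Y := by
    rw [abs_le] at *
    constructor <;> linarith
  rw [e, abs_mul]
  gcongr

/-- Uniform deviation of the data-fitting part `φ ^ 2 - 2 * φ * y` plus a regularizer that is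
bounded and Lipschitz in the parameters with a constant of order `√m`. -/
theorem uniform_deviation_fit_add (hR : 0 < R) (hκ : 1 ≤ κ) (hB : 0 < B) (hY : 0 < Y)
    {Ω : Set (EuclideanSpace ℝ (Fin d))} (hΩR : ∀ x ∈ Ω, ∀ i, |x i| ≤ R)
    {ρ : Measure (EuclideanSpace ℝ (Fin d))} [IsProbabilityMeasure ρ] (hΩ : ρ Ωᶜ = 0)
    {y : EuclideanSpace ℝ (Fin d) → ℝ} (hy : AEMeasurable y ρ) (hyY : ∀ x ∈ Ω, |y x| ≤ Y)
    {N : ℕ} (hm : 0 < m) (hN : 0 < N) (hτ : 1 / κ ≤ τ) {ε : ℝ} (hε : 0 < ε) (hε1 : ε < 1)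
    {F : NetworkParam d m B → EuclideanSpace ℝ (Fin d) → ℝ} {D L : ℝ} (hD : 0 < D) (hL : 0 < L)
    (hF : ∀ θ, Continuous (F θ)) (hFb : ∀ θ, ∀ x ∈ Ω, |F θ x| ≤ D)
    (hFlip : ∀ θ θ' δ, 0 ≤ δ → (∀ j, |θ.coord j - θ'.coord j| ≤ δ) → ∀ x ∈ Ω,
      |F θ x - F θ' x| ≤ L * √(m : ℝ) * δ) :
    ENNReal.ofReal (1 - ε) ≤ Measure.pi (fun _ : Fin N => ρ)
      {x | ∀ θ : NetworkParam d m B, |empiricalDeviation ρ x fun z =>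
          θ.eval τ z ^ 2 - 2 * θ.eval τ z * y z + F θ z| ≤
        2 * (√(m : ℝ) / √(N : ℝ)) * (2 * fitBound R κ B Y * entropyConstant d
            (resolution B (fitBound R κ B Y) (fitLip R κ B d Y)) +
          2 * D * entropyConstant d (resolution B D L) +
          8 * D * √((d : ℝ) + 3) * √(Real.log m)) +
        8 * (fitBound R κ B Y + D) * (√(-2 * Real.log ε) / √(N : ℝ))} := by
  have hτ0 : 0 < τ := lt_of_lt_of_le (by positivity) hτ
  have hm' : (1 : ℝ) ≤ m := by exact_mod_cast hm
  have hm1 : 1 ≤ √(m : ℝ) := Real.one_le_sqrt.mpr hm'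
  have hD₁ := fitBound_pos hR hκ hB hY
  have hL₁ := fitLip_pos (d := d) hR hκ hB hY
  have hh₁ := one_le_resolution hB hD₁ hL₁
  have hh := one_le_resolution hB hD hL
  set D₁ := fitBound R κ B Y
  set L₁ := fitLip R κ B d Y
  set h₁ := resolution B D₁ L₁
  set h := resolution B D L
  set f : NetworkParam d m B → EuclideanSpace ℝ (Fin d) → ℝ :=
    fun θ z => θ.eval τ z ^ 2 - 2 * θ.eval τ z * y z with hf
  have hfm : ∀ θ, AEMeasurable (f θ) ρ := fun θ =>
    ((θ.continuous_eval hτ0.ne').aemeasurable.pow_const 2).sub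
      (((θ.continuous_eval hτ0.ne').aemeasurable.const_mul 2).mul hy)
  have hfb : ∀ θ, ∀ x ∈ Ω, |f θ x| ≤ D₁ := fun θ x hx =>
    abs_fit_le (θ.abs_eval_le hR hκ hτ hm hB.le (hΩR x hx)) (hyY x hx)
  have hflip : ∀ θ θ' δ, 0 ≤ δ → (∀ j, |θ.coord j - θ'.coord j| ≤ δ) → ∀ x ∈ Ω,
      |f θ x - f θ' x| ≤ L₁ * δ := fun θ θ' δ _ h x hx =>
    (abs_fit_sub_le (θ.abs_eval_le hR hκ hτ hm hB.le (hΩR x hx))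
      (θ'.abs_eval_le hR hκ hτ hm hB.le (hΩR x hx)) (hyY x hx)
      (abs_eval_sub_le hR hκ hτ hm hB.le h (hΩR x hx))).trans
      (mul_assoc _ _ _).ge
  have haeΩ : ∀ᵐ x ∂ρ, x ∈ Ω := mem_ae_iff.mpr hΩ
  -- There are `m * (d + 2) + 1` coordinates, and `1 ≤ m` absorbs the bias.
  have hcard : (Fintype.card (Option (Fin m × Option (Option (Fin d)))) : ℝ) ≤ m * (d + 3) := by
    simp only [Fintype.card_option, Fintype.card_prod, Fintype.card_fin]
    push_cast
    linarith
  have b₁ := measure_not_forall_abs_empiricalDeviation_le_of_lipschitz hN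
    (coord : NetworkParam d m B → _) (H := h₁) hΩ (half_pos hε) (by linarith) hD₁ hL₁ hh₁
    (by positivity) (mul_le_mul_resolution hD₁) (abs_coord_le hB.le) hfm hfb hflip
  have b₂ := measure_not_forall_abs_empiricalDeviation_le_of_lipschitz hN
    (coord : NetworkParam d m B → _) (L := L * √(m : ℝ)) (H := h * √(m : ℝ)) hΩ (half_pos hε)
    (by linarith) hD (by positivity) (one_le_mul_of_one_le_of_one_le hh hm1) (by positivity)
    (by
      rw [← mul_assoc, ← mul_assoc]
      exact mul_le_mul_of_nonneg_right (mul_le_mul_resolution hD) (by positivity))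
    (abs_coord_le hB.le) (fun θ => (hF θ).aemeasurable) hFb hFlip
  -- The fit has `ℓ = 0`. For the regularizer `log (h * √m) = log h + log m / 2`, so `ℓ = log m` is
  -- enough.
  have c₁ := chaining_bound_le (d := d) (h := h₁) (H := h₁) (ℓ := 0) hm (Nat.cast_nonneg _)
    hcard hh₁ (add_zero _).ge hε
  have c₂ := chaining_bound_le (d := d) (h := h) (H := h * √(m : ℝ)) (ℓ := Real.log m) hm
    (Nat.cast_nonneg _) hcard hh (by
      rw [Real.log_mul (by linarith) (by linarith), Real.log_sqrt (by positivity)]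
      linarith [Real.log_nonneg hm']) hε
  rw [Real.sqrt_zero, mul_zero, add_zero] at c₁
  refine ofReal_one_sub_le_of_measure_compl_le ((measure_union_le _ _).trans
    ((add_le_add b₁ b₂).trans ?_)) ?_ hε.le
  · rw [← ENNReal.ofReal_add (half_pos hε).le (half_pos hε).le, add_halves]
  intro x hx θ
  simp only [Set.mem_union, Set.mem_ofPred_eq, not_or, not_not] at hx
  have e := empiricalDeviation_add x
    (integrable_of_ae_abs_le (hfm θ) (haeΩ.mono fun z hz => hfb θ z hz))
    (integrable_of_ae_abs_le (hF θ).aemeasurable (haeΩ.mono fun z hz => hFb θ z hz))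
  rw [e]
  have hN' : (0 : ℝ) < √(N : ℝ) := Real.sqrt_pos.mpr (by exact_mod_cast hN)
  calc _ ≤ _ := (abs_add_le _ _).trans (add_le_add (hx.1 θ) (hx.2 θ))
    _ ≤ _ := add_le_add (mul_le_mul_of_nonneg_left c₁ (by positivity))
      (mul_le_mul_of_nonneg_left c₂ (by positivity))
    _ = _ := by ring

end NetworkParam

/-! ### The two regularized losses -/

theorem mainTheorem8 (R κ : ℝ) (hR : 0 < R) (hκ : 1 ≤ κ) :
    ∃ (Z₁ : ℝ → ℕ → ℝ → ℝ) (Z₂ Z₃ : ℝ → ℕ → ℝ) (M₁ M₂ : ℝ → ℝ → ℝ),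
      ∀ (B : ℝ) (d : ℕ) (Y : ℝ), 0 < B → 0 < Y →
      ∀ (Ω : Set (EuclideanSpace ℝ (Fin d))), (∀ x ∈ Ω, ∀ i, |x i| ≤ R) →
      ∀ (ρ : Measure (EuclideanSpace ℝ (Fin d))), IsProbabilityMeasure ρ → ρ Ωᶜ = 0 →
      ∀ (y : EuclideanSpace ℝ (Fin d) → ℝ), AEMeasurable y ρ → (∀ x ∈ Ω, |y x| ≤ Y) →
      ∀ (m N : ℕ), 0 < m → 0 < N →
      ∀ (τ : ℝ), 1 / κ ≤ τ → τ ≤ κ * √(m : ℝ) →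
      ∀ (ε : ℝ), 0 < ε → ε < 1 →
        ENNReal.ofReal (1 - ε) ≤ Measure.pi (fun _ : Fin N => ρ)
          {x | (⨆ φ ∈ networkClass (softplus τ) d m B,
                ((|empiricalLossTV x y φ - lossTV ρ y φ| : ℝ) : EReal)) ≤
              ((2 * (√(m : ℝ) / √(N : ℝ)) * (Z₁ B d Y + Z₂ B d * √(Real.log m)) +
                M₁ B Y * (√(-2 * Real.log ε) / √(N : ℝ)) : ℝ) : EReal)} ∧
        ENNReal.ofReal (1 - ε) ≤ Measure.pi (fun _ : Fin N => ρ)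
          {x | (⨆ φ ∈ networkClass (softplus τ) d m B,
                ((|empiricalLossTik x y φ - lossTik ρ y φ| : ℝ) : EReal)) ≤
              ((2 * (√(m : ℝ) / √(N : ℝ)) * (Z₁ B d Y + Z₃ B d * √(Real.log m)) +
                M₂ B Y * (√(-2 * Real.log ε) / √(N : ℝ)) : ℝ) : EReal)} := by
  let zFit : ℝ → ℕ → ℝ → ℝ := fun B d Y => 2 * fitBound R κ B Y * entropyConstant d
    (resolution B (fitBound R κ B Y) (fitLip R κ B d Y))
  let zTV : ℝ → ℕ → ℝ := fun B d => 2 * (16 * B) * entropyConstant d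
    (resolution B (16 * B) (gradLip R κ B d))
  let zTik : ℝ → ℕ → ℝ := fun B d => 2 * (16 * B) ^ 2 * entropyConstant d
    (resolution B ((16 * B) ^ 2) (2 * (16 * B) * gradLip R κ B d))
  -- The same `Z₁` must serve both losses, so it contains both regularizer terms; each case drops
  -- the other one, which is nonnegative.
  refine ⟨fun B d Y => zFit B d Y + zTV B d + zTik B d,
    fun B d => 8 * (16 * B) * √((d : ℝ) + 3), fun B d => 8 * (16 * B) ^ 2 * √((d : ℝ) + 3),
    fun B Y => 8 * (fitBound R κ B Y + 16 * B),
    fun B Y => 8 * (fitBound R κ B Y + (16 * B) ^ 2), ?_⟩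
  intro B d Y hB hY Ω hΩR ρ hρ hΩ y hy hyY m N hm hN τ hτ hτm ε hε hε1
  have hτ0 : 0 < τ := lt_of_lt_of_le (by positivity) hτ
  have hgL : 0 < gradLip R κ B d := gradLip_pos hR hκ hB
  have hzTV : 0 ≤ zTV B d := mul_nonneg (by positivity) (entropyConstant_nonneg _ _)
  have hzTik : 0 ≤ zTik B d := mul_nonneg (by positivity) (entropyConstant_nonneg _ _)
  have hgrad : ∀ (θ θ' : NetworkParam d m B) (δ : ℝ), 0 ≤ δ →
      (∀ j, |θ.coord j - θ'.coord j| ≤ δ) → ∀ x ∈ Ω,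
      |‖θ.grad τ x‖ - ‖θ'.grad τ x‖| ≤ gradLip R κ B d * √(m : ℝ) * δ :=
    fun θ θ' δ _ h x hx => (abs_norm_sub_norm_le _ _).trans
      (NetworkParam.norm_grad_sub_le hR hκ hτ0 hτm hm hB.le h (hΩR x hx))
  constructor
  · refine (NetworkParam.uniform_deviation_fit_add hR hκ hB hY hΩR hΩ hy hyY hm hN hτ hε hε1
      (F := fun θ z => ‖θ.grad τ z‖) (by positivity : 0 < 16 * B) hgL
      (fun θ => (θ.continuous_grad τ).norm)
      (fun θ x _ => by rw [abs_norm]; exact θ.norm_grad_le hm hB.le) hgrad).trans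
      (measure_mono fun x hx => iSup₂_le fun φ hφ => EReal.coe_le_coe_iff.mpr ?_)
    obtain ⟨θ, rfl⟩ := NetworkParam.exists_eval_eq hφ
    have h := hx θ
    rw [← θ.gradient_eval hτ0.ne'] at h
    refine h.trans (add_le_add_left (mul_le_mul_of_nonneg_left ?_ (by positivity)) _)
    simp only [zFit, zTV] at hzTV ⊢
    linarith
  · refine (NetworkParam.uniform_deviation_fit_add hR hκ hB hY hΩR hΩ hy hyY hm hN hτ hε hε1
      (F := fun θ z => ‖θ.grad τ z‖ ^ 2) (by positivity : 0 < (16 * B) ^ 2)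
      (by positivity : 0 < 2 * (16 * B) * gradLip R κ B d)
      (fun θ => (θ.continuous_grad τ).norm.pow 2)
      (fun θ x _ => ?_) (fun θ θ' δ hδ h x hx => ?_)).trans
      (measure_mono fun x hx => iSup₂_le fun φ hφ => EReal.coe_le_coe_iff.mpr ?_)
    · rw [abs_pow, abs_norm]
      exact pow_le_pow_left₀ (norm_nonneg _) (θ.norm_grad_le hm hB.le) 2
    · have h1 := hgrad θ θ' δ hδ h x hx
      have h2 : ‖θ.grad τ x‖ ≤ 16 * B := θ.norm_grad_le hm hB.le
      have h3 : ‖θ'.grad τ x‖ ≤ 16 * B := θ'.norm_grad_le hm hB.le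
      -- Squaring multiplies the Lipschitz constant by the sum of the two norms, at most `2 * (16 *
      -- B)`.
      rw [sq_sub_sq, abs_mul, abs_of_nonneg (by positivity : 0 ≤ ‖θ.grad τ x‖ + ‖θ'.grad τ x‖)]
      calc _ ≤ 2 * (16 * B) * (gradLip R κ B d * √(m : ℝ) * δ) :=
            mul_le_mul (by linarith) h1 (abs_nonneg _) (by positivity)
        _ = _ := by ring
    · obtain ⟨θ, rfl⟩ := NetworkParam.exists_eval_eq hφ
      have h := hx θ
      rw [← θ.gradient_eval hτ0.ne'] at h
      refine h.trans (add_le_add_left (mul_le_mul_of_nonneg_left ?_ (by positivity)) _)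
      simp only [zFit, zTik] at hzTik ⊢
      linarith
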